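/- **Model.** Let $\Omega_W$ be the set of continuous $w:[0,\infty)\to\mathbb R$ with $w(0)=0$, with the $\sigma$-algebra generated by the coordinate process $W$ and with Wiener measure $P_W$. On $\Omega=\Omega_W\times\mathbb R$ let $P$ be the completion of $P_W\otimes \mathrm{Exp}(1)$, and write $\Theta$ for the second coordinate. Let $\mathbb F$ be the completed filtration of $W$, let $\bar\lambda$ be a bounded, strictly positive, $\mathbb F$-predictable process, and put $\vartheta=\inf\{t\ge 0:\int_0^t\bar\lambda_s\,ds\ge\Theta\}$ (with $\inf\emptyset=\infty$), $N_t=\mathbf 1_{\vartheta\le t}$, $\lambda_t=\bar\lambda_t\mathbf 1_{t\le\vartheta}$ and $M_t=N_t-\int_0^t\lambda_s\,ds$. Let $\mathbb G$ be the usual augmentation of the filtration generated by $W$ and $N$; below, "adapted", "predictable" and "stopping time" refer to $\mathbb G$. Fix $T>0$, and assume that $\bar\lambda^{-1}$ is bounded on $\{t\le T\wedge\vartheta\}$. Let $\mathbb H^2$ (resp. $\mathbb H^2_\lambda$) be the set of predictable $Z$ with $E\int_0^T|Z_t|^2dt<\infty$ (resp. $E\int_0^T|Z_t|^2\lambda_t\,dt<\infty$),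 elements of $\mathbb H^2_\lambda$ being represented by processes that vanish after $\vartheta$. Let $S^2$ be the set of adapted right-continuous processes $X$ with left limits (RCLL) such that $E[\sup_{t\le T}|X_t|^2]<\infty$. Let $\sigma^1,\sigma^2>0$ be predictable, bounded, with bounded inverses. Let $U\subset\mathbb R$ be nonempty and closed, and let $g(t,\omega,y,z,k,\alpha)$, $\alpha\in U$, be measurable for the product of the predictable $\sigma$-algebra and the Borel $\sigma$-algebra of $\mathbb R^3\times U$, continuous in $\alpha$, with $E\int_0^T\sup_{\alpha\in U}|g(t,0,0,0,\alpha)|^2dt<\infty$. Assume that there are a constant $C\ge 0$ and a bounded measurable (predictable in $(t,\omega)$) $\theta_t^{y,z,k_1,k_2}>-1$ such that, $dP\otimes dt$-a.e. and for all arguments, $$|g(t,y_1,z_1,k_1,\alpha)-g(t,y_2,z_2,k_2,\alpha)|\le C\big(|y_1-y_2|+|z_1-z_2|+\sqrt{\lambda_t}\,|k_1-k_2|\big),$$ $$g(t,y,z,k_1,\alpha)-g(t,y,z,k_2,\alpha)\ge\theta_t^{y,z,k_1,k_2}(k_1-k_2)\lambda_t .$$ Let $\mathcal U$ be the set of $U$-valued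 predictable processes. For $\alpha\in\mathcal U$, $x\in\mathbb R$ and a strategy $\varphi=(\varphi^1,\varphi^2)\in\mathbb H^2\times\mathbb H^2_\lambda$, the wealth process $V^{\alpha,x,\varphi}$ is the solution on $[0,T]$ of $$V_t=x-\int_0^t g\big(s,V_s,\varphi_s^1\sigma_s^1+\varphi_s^2\sigma_s^2,-\varphi_s^2,\alpha_s\big)ds+\int_0^t(\varphi_s^1\sigma_s^1+\varphi_s^2\sigma_s^2)\,dW_s-\int_0^t\varphi_s^2\,dM_s .$$ **Payoffs.** Let $\xi,\zeta\in S^2$ with $\xi_T=\zeta_T$ a.s. and $\xi_t\le\zeta_t$ for $0\le t\le T$ a.s., and assume that there are nonnegative RCLL supermartingales $H,H'\in S^2$ with $\xi\le H-H'\le\zeta$ on $[0,T]$ a.s. (Mokobodzki's condition). **Prices.** Let $\mathcal T$ be the set of stopping times with values in $[0,T]$ a.s. A *seller's robust super-hedge* for payoffs $(\xi,\zeta)$ and initial wealth $x$ is a pair $(\sigma,\varphi)$ of $\sigma\in\mathcal T$ and a strategy $\varphi$ such that, for every $\alpha\in\mathcal U$, $V^{\alpha,x,\varphi}_t\ge\xi_t$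 for $0\le t\le\sigma$ a.s. and $V^{\alpha,x,\varphi}_\sigma\ge\zeta_\sigma$ a.s. The *seller's robust price* $\mathbf u_0(\xi,\zeta)$ is the infimum of the $x\in\mathbb R$ for which such a pair exists. A *buyer's robust super-hedge* for payoffs $(\xi,\zeta)$ and initial price $z$ is a pair $(\tau,\varphi)$ of $\tau\in\mathcal T$ and a strategy $\varphi$ such that, for every $\alpha\in\mathcal U$, $V^{\alpha,-z,\varphi}_t\ge-\zeta_t$ for $0\le t<\tau$ a.s. and $V^{\alpha,-z,\varphi}_\tau\ge-\xi_\tau$ a.s. The *buyer's robust price* $\tilde{\mathbf u}_0(\xi,\zeta)$ is the supremum of the $z\in\mathbb R$ for which such a pair exists. Infimum and supremum are taken in $[-\infty,\infty]$. **Theorem.** The buyer's robust price of the game option with payoffs $(\xi,\zeta)$ is the opposite of the seller's robust price of the game option with payoffs $(-\zeta,-\xi)$: $$\tilde{\mathbf u}_0(\xi,\zeta)=-\,\mathbf u_0(-\zeta,-\xi).$$ -/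

import Mathlib

open MeasureTheory ProbabilityTheory Filter Topology Set
open scoped NNReal ENNReal

noncomputable section

namespace GameOption

/-! ### Processes on a filtered probability space

Processes are indexed by `ℝ≥0`; for a horizon `T`, only their values on `[0, T]` matter. -/

section Processes

variable {Ω : Type*} {mΩ : MeasurableSpace Ω}

/-- Lebesgue measure on the time axis `[0, ∞)`. -/
def timeMeasure : Measure ℝ≥0 := (volume : Measure ℝ).comap ((↑) : ℝ≥0 → ℝ)

lemma timeMeasure_Icc (t : ℝ≥0) : timeMeasure (Icc 0 t) = t := by
  have h : MeasurableEmbedding ((↑) : ℝ≥0 → ℝ) :=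
    MeasurableEmbedding.subtype_coe (measurableSet_Ici (a := (0 : ℝ)))
  rw [timeMeasure, h.comap_apply]
  have : ((↑) : ℝ≥0 → ℝ) '' Icc 0 t = Icc (0 : ℝ) t := by
    ext x
    constructor
    · rintro ⟨y, hy, rfl⟩
      exact ⟨y.2, NNReal.coe_le_coe.2 hy.2⟩
    · rintro ⟨h0, h1⟩
      exact ⟨⟨x, h0⟩, ⟨zero_le, NNReal.coe_le_coe.1 h1⟩, rfl⟩
  rw [this, Real.volume_Icc]
  simp

/-- The completion of a filtration: every `P`-null event is added to each `σ`-algebra. -/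
def completeFiltration (P : Measure Ω) (𝓕 : Filtration ℝ≥0 mΩ) : Filtration ℝ≥0 mΩ where
  seq t := 𝓕 t ⊔ MeasurableSpace.generateFrom {A | MeasurableSet[mΩ] A ∧ P A = 0}
  mono' _ _ h := sup_le_sup_right (𝓕.mono h) _
  le' t := sup_le (𝓕.le t) (MeasurableSpace.generateFrom_le fun _ hA => hA.1)

/-- The usual augmentation of a filtration: completed, then made right-continuous. -/
def augmentFiltration (P : Measure Ω) (𝓕 : Filtration ℝ≥0 mΩ) : Filtration ℝ≥0 mΩ :=
  (completeFiltration P 𝓕).rightCont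

/-- Almost every path is right-continuous on `[0, T)` with left limits on `(0, T]`. -/
def IsRCLL (P : Measure Ω) (T : ℝ≥0) (X : ℝ≥0 → Ω → ℝ) : Prop :=
  ∀ᵐ ω ∂P, (∀ t < T, ContinuousWithinAt (fun s => X s ω) (Ici t) t) ∧
    ∀ t ≤ T, ∃ l : ℝ, Tendsto (fun s => X s ω) (𝓝[<] t) (𝓝 l)

/-- The space `S²`: adapted RCLL processes with `E[sup_{t ≤ T} |X_t|²] < ∞`. -/
def MemS2 (P : Measure Ω) (𝔾 : Filtration ℝ≥0 mΩ) (T : ℝ≥0) (X : ℝ≥0 → Ω → ℝ) : Prop :=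
  Adapted 𝔾 X ∧ IsRCLL P T X ∧ ∫⁻ ω, (⨆ t ∈ Icc 0 T, ‖X t ω‖ₑ) ^ 2 ∂P < ∞

/-- `E[∫₀ᵀ |Z_t|² ρ_t dt]`, with values in `[0, ∞]`. -/
def sqNorm (P : Measure Ω) (T : ℝ≥0) (ρ Z : ℝ≥0 → Ω → ℝ) : ℝ≥0∞ :=
  ∫⁻ ω, ∫⁻ t in Icc 0 T, ‖Z t ω‖ₑ ^ 2 * ENNReal.ofReal (ρ t ω) ∂timeMeasure ∂P

/-- Predictable processes `Z` with `E[∫₀ᵀ |Z_t|² ρ_t dt] < ∞`: this is `ℍ²` for `ρ = 1` and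
`ℍ²_λ` for `ρ = λ`. -/
def MemH2 (P : Measure Ω) (𝔾 : Filtration ℝ≥0 mΩ) (T : ℝ≥0) (ρ Z : ℝ≥0 → Ω → ℝ) : Prop :=
  IsStronglyPredictable 𝔾 Z ∧ sqNorm P T ρ Z < ∞

/-- A simple predictable process `∑_{i < n} c_i 1_{(t_i, t_{i+1}]}`, where `c_i` is bounded and
`𝔾_{t_i}`-measurable. -/
structure SimpleProcess (𝔾 : Filtration ℝ≥0 mΩ) where
  n : ℕ
  time : ℕ → ℝ≥0
  coef : ℕ → Ω → ℝ
  mono : Monotone time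
  meas : ∀ i, Measurable[𝔾 (time i)] (coef i)
  bdd : ∃ C : ℝ, ∀ i ω, |coef i ω| ≤ C

/-- The process itself. -/
def SimpleProcess.val {𝔾 : Filtration ℝ≥0 mΩ} (H : SimpleProcess 𝔾) (t : ℝ≥0) (ω : Ω) : ℝ :=
  ∑ i ∈ Finset.range H.n, (Ioc (H.time i) (H.time (i + 1))).indicator (fun _ => H.coef i ω) t

/-- The elementary stochastic integral
`∫₀ᵗ H dX = ∑_{i < n} c_i (X_{t_{i+1} ∧ t} - X_{t_i ∧ t})`. -/
def SimpleProcess.integral {𝔾 : Filtration ℝ≥0 mΩ} (H : SimpleProcess 𝔾)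
    (X : ℝ≥0 → Ω → ℝ) (t : ℝ≥0) (ω : Ω) : ℝ :=
  ∑ i ∈ Finset.range H.n, H.coef i ω * (X (min (H.time (i + 1)) t) ω - X (min (H.time i) t) ω)

/-- `I` is (a version of) the stochastic integral `∫₀^· H dX` on `[0, T]`, for a square-integrable
martingale `X` with predictable bracket `∫₀^· ρ_s ds` and an integrand `H` in `L²(ρ dt ⊗ dP)`:
an adapted RCLL process that is the limit, in the norm `E[sup_{t ≤ T} |·|²]^{1/2}`, of elementary
integrals of simple predictable processes converging to `H` in `L²(ρ dt ⊗ dP)`. -/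
def IsStochIntegral (P : Measure Ω) (𝔾 : Filtration ℝ≥0 mΩ) (T : ℝ≥0)
    (X ρ H I : ℝ≥0 → Ω → ℝ) : Prop :=
  Adapted 𝔾 I ∧ IsRCLL P T I ∧ ∃ h : ℕ → SimpleProcess 𝔾,
    Tendsto (fun n => sqNorm P T ρ (fun t ω => (h n).val t ω - H t ω)) atTop (𝓝 0) ∧
    Tendsto (fun n => ∫⁻ ω, (⨆ t ∈ Icc 0 T, ‖(h n).integral X t ω - I t ω‖ₑ) ^ 2 ∂P)
      atTop (𝓝 0)

lemma predictable_le_prod (𝔾 : Filtration ℝ≥0 mΩ) :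
    𝔾.predictable ≤ (inferInstance : MeasurableSpace (ℝ≥0 × Ω)) := by
  refine measurableSpace_le_predictable_of_measurableSet (fun A hA => ?_) (fun i A hA => ?_)
  · exact (measurableSet_singleton _).prod (𝔾.le _ A hA)
  · exact measurableSet_Ioi.prod (𝔾.le i A hA)

end Processes

/-! ### The canonical space of the Cox process model -/

/-- Continuous paths `w : [0, ∞) → ℝ` with `w 0 = 0`; as a subtype of `ℝ≥0 → ℝ` it carries the
`σ`-algebra generated by the coordinate process. -/
abbrev WienerSpace : Type := {w : ℝ≥0 → ℝ // Continuous w ∧ w 0 = 0}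

/-- `P_W` is Wiener measure: under it the coordinate process is a standard Brownian motion. -/
def IsWienerMeasure (PW : Measure WienerSpace) : Prop :=
  IsBrownianReal (fun t (w : WienerSpace) => w.1 t) PW

/-- The product of `P_W` and of the exponential law with parameter `1` on `ℝ`. -/
def productMeasure (PW : Measure WienerSpace) : Measure (WienerSpace × ℝ) :=
  PW.prod (expMeasure 1)

/-- The canonical space `Ω = Ω_W × ℝ` with the completed `σ`-algebra. -/
abbrev CanonicalSpace (PW : Measure WienerSpace) : Type :=
  NullMeasurableSpace (WienerSpace × ℝ) (productMeasure PW)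

section Model

variable {PW : Measure WienerSpace}

variable (PW) in
/-- The completed probability on the canonical space. -/
def prob : Measure (CanonicalSpace PW) := (productMeasure PW).completion

/-- The Brownian motion `W_t(w, θ) = w(t)`. -/
def brownian (t : ℝ≥0) (ω : CanonicalSpace PW) : ℝ :=
  (Prod.fst (α := WienerSpace) (β := ℝ) ω).1 t

/-- The exponential variable `Θ(w, θ) = θ`. -/
def threshold (ω : CanonicalSpace PW) : ℝ := Prod.snd (α := WienerSpace) (β := ℝ) ω

lemma measurable_of_product {f : WienerSpace × ℝ → ℝ} (hf : Measurable f) :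
    Measurable (fun ω : CanonicalSpace PW => f ω) :=
  fun _ hs => (hf hs).nullMeasurableSet

lemma measurable_brownian (t : ℝ≥0) : Measurable (brownian (PW := PW) t) :=
  measurable_of_product (f := fun p => p.1.1 t)
    ((measurable_pi_apply t).comp (measurable_subtype_coe.comp measurable_fst))

lemma measurable_threshold : Measurable (threshold (PW := PW)) :=
  measurable_of_product (f := fun p => p.2) measurable_snd

variable (PW) in
/-- The natural filtration of `W` on the canonical space. -/
def brownianNatural : Filtration ℝ≥0 (inferInstance : MeasurableSpace (CanonicalSpace PW)) :=
  Filtration.natural brownian fun t => (measurable_brownian t).stronglyMeasurable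

variable (PW) in
/-- The filtration `𝔽`: the completed filtration of `W`. -/
def brownianFiltration : Filtration ℝ≥0 (inferInstance : MeasurableSpace (CanonicalSpace PW)) :=
  completeFiltration (prob PW) (brownianNatural PW)

variable (PW) in
/-- A bounded positive `𝔽`-predictable process `λ̄`. -/
structure PreIntensity where
  val : ℝ≥0 → CanonicalSpace PW → ℝ
  predictable : IsStronglyPredictable (brownianFiltration PW) val
  pos : ∀ t ω, 0 < val t ω
  bdd : ∃ C : ℝ, ∀ t ω, val t ω ≤ C

namespace PreIntensity

variable (lam : PreIntensity PW)

/-- The integrated process `∫₀ᵗ λ̄_s ds`. -/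
def cumulative (t : ℝ≥0) (ω : CanonicalSpace PW) : ℝ :=
  ∫ s in Icc 0 t, lam.val s ω ∂timeMeasure

/-- The default time `ϑ = inf {t ≥ 0 : ∫₀ᵗ λ̄_s ds ≥ Θ}`, with `inf ∅ = ∞`. -/
def defaultTime (ω : CanonicalSpace PW) : ℝ≥0∞ :=
  ⨅ (t : ℝ≥0) (_ : threshold ω ≤ lam.cumulative t ω), (t : ℝ≥0∞)

open scoped Classical in
/-- The default process `N_t = 1_{ϑ ≤ t}`. -/
def defaultProcess (t : ℝ≥0) (ω : CanonicalSpace PW) : ℝ :=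
  if lam.defaultTime ω ≤ t then 1 else 0

open scoped Classical in
/-- The intensity `λ_t = λ̄_t 1_{t ≤ ϑ}`. -/
def intensity (t : ℝ≥0) (ω : CanonicalSpace PW) : ℝ :=
  if (t : ℝ≥0∞) ≤ lam.defaultTime ω then lam.val t ω else 0

/-- The compensated default martingale `M_t = N_t - ∫₀ᵗ λ_s ds`. -/
def compensated (t : ℝ≥0) (ω : CanonicalSpace PW) : ℝ :=
  lam.defaultProcess t ω - ∫ s in Icc 0 t, lam.intensity s ω ∂timeMeasure

lemma measurable_uncurry : Measurable (Function.uncurry lam.val) :=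
  lam.predictable.measurable.mono (predictable_le_prod _) le_rfl

lemma finite_restrict (t : ℝ≥0) : IsFiniteMeasure (timeMeasure.restrict (Icc 0 t)) :=
  ⟨by rw [Measure.restrict_apply_univ, timeMeasure_Icc]; exact ENNReal.coe_lt_top⟩

lemma measurable_cumulative (t : ℝ≥0) : Measurable (lam.cumulative t) := by
  have := finite_restrict t
  exact (StronglyMeasurable.integral_prod_right (f := fun ω s => lam.val s ω)
    (lam.measurable_uncurry.comp measurable_swap).stronglyMeasurable).measurable

lemma cumulative_mono {s t : ℝ≥0} (hst : s ≤ t) (ω : CanonicalSpace PW) :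
    lam.cumulative s ω ≤ lam.cumulative t ω := by
  have := finite_restrict t
  obtain ⟨C, hC⟩ := lam.bdd
  refine setIntegral_mono_set ?_ ?_ ?_
  · refine Integrable.of_bound
      (lam.measurable_uncurry.comp measurable_prodMk_right).aestronglyMeasurable C ?_
    exact Eventually.of_forall fun u => by
      change ‖lam.val u ω‖ ≤ C
      rw [Real.norm_of_nonneg (lam.pos u ω).le]
      exact hC u ω
  · exact Eventually.of_forall fun u => (lam.pos u ω).le
  · exact (Icc_subset_Icc_right hst).eventuallyLE

lemma measurable_defaultTime : Measurable lam.defaultTime := by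
  refine measurable_of_Iio fun a => ?_
  have : lam.defaultTime ⁻¹' Iio a =
      ⋃ q : ℚ, ⋃ _ : ((Real.toNNReal q : ℝ≥0) : ℝ≥0∞) < a,
        {ω | threshold ω ≤ lam.cumulative (Real.toNNReal q) ω} := by
    ext ω
    simp only [mem_preimage, mem_Iio, defaultTime, iInf_lt_iff, mem_iUnion, mem_ofPred_eq,
      exists_prop]
    constructor
    · rintro ⟨t, ht, hta⟩
      obtain ⟨q, hq0, hq1, hq2⟩ := ENNReal.lt_iff_exists_rat_btwn.1 hta
      refine ⟨q, hq2, ht.trans (lam.cumulative_mono ?_ ω)⟩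
      exact_mod_cast hq1.le
    · rintro ⟨q, hq, h⟩
      exact ⟨_, h, hq⟩
  rw [this]
  exact MeasurableSet.iUnion fun q => MeasurableSet.iUnion fun _ =>
    measurableSet_le measurable_threshold (lam.measurable_cumulative _)

lemma measurable_defaultProcess (t : ℝ≥0) : Measurable (lam.defaultProcess t) :=
  Measurable.ite (measurableSet_le lam.measurable_defaultTime measurable_const)
    measurable_const measurable_const

/-- The filtration `𝔾`: the usual augmentation of the filtration generated by `W` and `N`. -/
def fullFiltration : Filtration ℝ≥0 (inferInstance : MeasurableSpace (CanonicalSpace PW)) :=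
  augmentFiltration (prob PW) <| brownianNatural PW ⊔
    Filtration.natural lam.defaultProcess
      fun t => (lam.measurable_defaultProcess t).stronglyMeasurable

end PreIntensity

variable (PW) in
/-- The market model with ambiguity: the horizon `T > 0`, the process `λ̄`, the volatilities
`σ¹, σ²`, the set `U` of ambiguity parameters and the driver `g(t, ω, y, z, k, α)`, with their
standing assumptions. -/
structure AmbiguousMarket where
  T : ℝ≥0
  T_pos : 0 < T
  lam : PreIntensity PW
  /-- `λ⁻¹` is bounded up to the default time. -/
  inv_intensity_bdd : ∃ C : ℝ, ∀ᵐ ω ∂prob PW, ∀ t ≤ T, (t : ℝ≥0∞) ≤ lam.defaultTime ω →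
    (lam.val t ω)⁻¹ ≤ C
  vol₁ : ℝ≥0 → CanonicalSpace PW → ℝ
  vol₂ : ℝ≥0 → CanonicalSpace PW → ℝ
  vol₁_predictable : IsStronglyPredictable lam.fullFiltration vol₁
  vol₂_predictable : IsStronglyPredictable lam.fullFiltration vol₂
  vol₁_pos : ∀ t ≤ T, ∀ ω, 0 < vol₁ t ω
  vol₂_pos : ∀ t ≤ T, ∀ ω, 0 < vol₂ t ω
  vol_bdd : ∃ C : ℝ, ∀ t ≤ T, ∀ ω,
    vol₁ t ω ≤ C ∧ (vol₁ t ω)⁻¹ ≤ C ∧ vol₂ t ω ≤ C ∧ (vol₂ t ω)⁻¹ ≤ C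
  U : Set ℝ
  U_nonempty : U.Nonempty
  U_closed : IsClosed U
  g : ℝ≥0 → CanonicalSpace PW → ℝ → ℝ → ℝ → U → ℝ
  g_measurable :
    @Measurable ((ℝ≥0 × CanonicalSpace PW) × (ℝ × ℝ × ℝ) × U) ℝ
      (lam.fullFiltration.predictable.prod inferInstance) inferInstance
      (fun p => g p.1.1 p.1.2 p.2.1.1 p.2.1.2.1 p.2.1.2.2 p.2.2)
  /-- `g` is uniformly `λ`-admissible: Lipschitz, with a constant that does not depend on `α`. -/
  g_lipschitz : ∃ C : ℝ, 0 ≤ C ∧ ∀ᵐ ω ∂prob PW, ∀ᵐ t ∂timeMeasure.restrict (Icc 0 T),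
    ∀ (a : U) (y₁ z₁ k₁ y₂ z₂ k₂ : ℝ),
      |g t ω y₁ z₁ k₁ a - g t ω y₂ z₂ k₂ a| ≤
        C * (|y₁ - y₂| + |z₁ - z₂| + √(lam.intensity t ω) * |k₁ - k₂|)
  g_continuous : ∀ t ≤ T, ∀ ω y z k, Continuous (g t ω y z k)
  /-- `sup_α |g(·, 0, 0, 0, α)|` belongs to `ℍ²`. -/
  g_zero : ∫⁻ ω, ∫⁻ t in Icc 0 T, (⨆ a : U, ‖g t ω 0 0 0 a‖ₑ) ^ 2 ∂timeMeasure ∂prob PW < ∞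
  /-- `g(t, y, z, k₁, α) - g(t, y, z, k₂, α) ≥ θ_t^{y,z,k₁,k₂} (k₁ - k₂) λ_t` for some bounded
  measurable `θ > -1`. -/
  g_jump : ∃ θ : ℝ≥0 → CanonicalSpace PW → ℝ → ℝ → ℝ → ℝ → ℝ,
    @Measurable ((ℝ≥0 × CanonicalSpace PW) × ℝ × ℝ × ℝ × ℝ) ℝ
      (lam.fullFiltration.predictable.prod inferInstance) inferInstance
      (fun p => θ p.1.1 p.1.2 p.2.1 p.2.2.1 p.2.2.2.1 p.2.2.2.2) ∧
    (∃ C : ℝ, ∀ t ≤ T, ∀ ω y z k₁ k₂, |θ t ω y z k₁ k₂| ≤ C) ∧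
    (∀ᵐ ω ∂prob PW, ∀ t ≤ T, ∀ y z k₁ k₂, -1 < θ t ω y z k₁ k₂) ∧
    ∀ᵐ ω ∂prob PW, ∀ᵐ t ∂timeMeasure.restrict (Icc 0 T), ∀ (a : U) (y z k₁ k₂ : ℝ),
      θ t ω y z k₁ k₂ * (k₁ - k₂) * lam.intensity t ω ≤ g t ω y z k₁ a - g t ω y z k₂ a

namespace AmbiguousMarket

variable (𝓜 : AmbiguousMarket PW)

/-- The filtration `𝔾` of the market. -/
abbrev filtration : Filtration ℝ≥0 (inferInstance : MeasurableSpace (CanonicalSpace PW)) :=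
  𝓜.lam.fullFiltration

/-- The set `𝒰` of controls: the `U`-valued predictable processes. -/
structure Control where
  val : ℝ≥0 → CanonicalSpace PW → 𝓜.U
  predictable : IsStronglyPredictable 𝓜.filtration val

/-- The set `𝒯` of stopping times with values in `[0, T]` almost surely. -/
structure StoppingTime where
  val : CanonicalSpace PW → ℝ≥0
  isStoppingTime : IsStoppingTime 𝓜.filtration (fun ω => (val ω : WithTop ℝ≥0))
  le_T : ∀ᵐ ω ∂prob PW, val ω ≤ 𝓜.T

/-- Risky-assets strategies `φ = (φ¹, φ²)` in `ℍ² × ℍ²_λ`. The component `φ²` is the representative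
that vanishes after the default time, when the defaultable asset is worthless. -/
structure Strategy where
  fst : ℝ≥0 → CanonicalSpace PW → ℝ
  snd : ℝ≥0 → CanonicalSpace PW → ℝ
  mem_fst : MemH2 (prob PW) 𝓜.filtration 𝓜.T (fun _ _ => 1) fst
  mem_snd : MemH2 (prob PW) 𝓜.filtration 𝓜.T 𝓜.lam.intensity snd
  snd_after_default : ∀ᵐ ω ∂prob PW, ∀ t ≤ 𝓜.T, 𝓜.lam.defaultTime ω < t → snd t ω = 0

/-- The integrand `φ'σ = φ¹σ¹ + φ²σ²` with respect to `W`. -/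
def Strategy.exposure {𝓜 : AmbiguousMarket PW} (φ : 𝓜.Strategy) (t : ℝ≥0)
    (ω : CanonicalSpace PW) : ℝ :=
  φ.fst t ω * 𝓜.vol₁ t ω + φ.snd t ω * 𝓜.vol₂ t ω

/-- `V` is (a version of) the wealth process `V^{α,x,φ}` in the market `𝓜_α`: an adapted RCLL process with
`V_t = x - ∫₀ᵗ g(s, V_s, φ_s'σ_s, -φ²_s, α_s) ds + ∫₀ᵗ φ_s'σ_s dW_s - ∫₀ᵗ φ²_s dM_s` on `[0, T]`.
These conditions determine `V` up to indistinguishability. -/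
def IsWealth (α : 𝓜.Control) (x : ℝ) (φ : 𝓜.Strategy) (V : ℝ≥0 → CanonicalSpace PW → ℝ) :
    Prop :=
  Adapted 𝓜.filtration V ∧ IsRCLL (prob PW) 𝓜.T V ∧
    ∃ IW IM : ℝ≥0 → CanonicalSpace PW → ℝ,
      IsStochIntegral (prob PW) 𝓜.filtration 𝓜.T brownian (fun _ _ => 1) φ.exposure IW ∧
      IsStochIntegral (prob PW) 𝓜.filtration 𝓜.T 𝓜.lam.compensated 𝓜.lam.intensity φ.snd IM ∧
      ∀ᵐ ω ∂prob PW,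
        IntegrableOn (fun s => 𝓜.g s ω (V s ω) (φ.exposure s ω) (-φ.snd s ω) (α.val s ω))
          (Icc 0 𝓜.T) timeMeasure ∧
        ∀ t ≤ 𝓜.T, V t ω = x
          - ∫ s in Icc 0 t, 𝓜.g s ω (V s ω) (φ.exposure s ω) (-φ.snd s ω) (α.val s ω) ∂timeMeasure
          + IW t ω - IM t ω

/-- Payoff processes `(ξ, ζ)` of a game option: RCLL processes in `S²` with `ξ_T = ζ_T` and `ξ ≤ ζ`
that satisfy Mokobodzki's condition, i.e. a difference of two nonnegative RCLL supermartingales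
in `S²` lies between them. -/
structure IsPayoff (ξ ζ : ℝ≥0 → CanonicalSpace PW → ℝ) : Prop where
  mem_left : MemS2 (prob PW) 𝓜.filtration 𝓜.T ξ
  mem_right : MemS2 (prob PW) 𝓜.filtration 𝓜.T ζ
  terminal : ∀ᵐ ω ∂prob PW, ζ 𝓜.T ω = ξ 𝓜.T ω
  le : ∀ᵐ ω ∂prob PW, ∀ t ≤ 𝓜.T, ξ t ω ≤ ζ t ω
  mokobodzki : ∃ H H' : ℝ≥0 → CanonicalSpace PW → ℝ,
    MemS2 (prob PW) 𝓜.filtration 𝓜.T H ∧ MemS2 (prob PW) 𝓜.filtration 𝓜.T H' ∧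
    Supermartingale H 𝓜.filtration (prob PW) ∧ Supermartingale H' 𝓜.filtration (prob PW) ∧
    ∀ᵐ ω ∂prob PW, ∀ t ≤ 𝓜.T, 0 ≤ H t ω ∧ 0 ≤ H' t ω ∧
      ξ t ω ≤ H t ω - H' t ω ∧ H t ω - H' t ω ≤ ζ t ω

/-- The seller's robust super-hedges `(σ, φ)` against the game option with payoffs `(ξ, ζ)`, for
the initial wealth `x`: for every `α ∈ 𝒰`, `V^{α,x,φ}_t ≥ ξ_t` for `0 ≤ t ≤ σ` a.s. and
`V^{α,x,φ}_σ ≥ ζ_σ` a.s. -/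
def sellerSuperHedges (ξ ζ : ℝ≥0 → CanonicalSpace PW → ℝ) (x : ℝ) :
    Set (𝓜.StoppingTime × 𝓜.Strategy) :=
  {p | ∀ α : 𝓜.Control, ∃ V, 𝓜.IsWealth α x p.2 V ∧
    (∀ᵐ ω ∂prob PW, ∀ t ≤ p.1.val ω, ξ t ω ≤ V t ω) ∧
    ∀ᵐ ω ∂prob PW, ζ (p.1.val ω) ω ≤ V (p.1.val ω) ω}

/-- The seller's robust price: the infimum, in `[-∞, ∞]`, of the initial wealths that allow a
robust super-hedge. -/
def sellerRobustPrice (ξ ζ : ℝ≥0 → CanonicalSpace PW → ℝ) : EReal :=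
  sInf ((fun x : ℝ => (x : EReal)) '' {x | (𝓜.sellerSuperHedges ξ ζ x).Nonempty})

/-- The buyer's robust super-hedges `(τ, φ)` against the game option with payoffs `(ξ, ζ)`, for
the initial price `z`: for every `α ∈ 𝒰`, `V^{α,-z,φ}_t ≥ -ζ_t` for `0 ≤ t < τ` a.s. and
`V^{α,-z,φ}_τ ≥ -ξ_τ` a.s. -/
def buyerSuperHedges (ξ ζ : ℝ≥0 → CanonicalSpace PW → ℝ) (z : ℝ) :
    Set (𝓜.StoppingTime × 𝓜.Strategy) :=
  {p | ∀ α : 𝓜.Control, ∃ V, 𝓜.IsWealth α (-z) p.2 V ∧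
    (∀ᵐ ω ∂prob PW, ∀ t < p.1.val ω, -ζ t ω ≤ V t ω) ∧
    ∀ᵐ ω ∂prob PW, -ξ (p.1.val ω) ω ≤ V (p.1.val ω) ω}

/-- The buyer's robust price: the supremum, in `[-∞, ∞]`, of the initial prices that allow a
robust super-hedge. -/
def buyerRobustPrice (ξ ζ : ℝ≥0 → CanonicalSpace PW → ℝ) : EReal :=
  sSup ((fun z : ℝ => (z : EReal)) '' {z | (𝓜.buyerSuperHedges ξ ζ z).Nonempty})

end AmbiguousMarket

end Model

end GameOption

end

/-! The buyer's super-hedges at price `z` for `(ξ, ζ)` are exactly the seller's super-hedges at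
wealth `-z` for `(-ζ, -ξ)`. Both require `V ≥ -ζ` strictly before the stopping time and `V ≥ -ξ` at
it; the seller also requires `V ≥ -ζ` at the stopping time, which follows from `ξ ≤ ζ` because the
stopping time is almost surely at most `T`. The admissible prices and wealths are therefore
exchanged by `z ↦ -z`, and this reflection turns the supremum into minus the infimum. -/

namespace GameOption.AmbiguousMarket

variable {PW : Measure WienerSpace} (𝓜 : AmbiguousMarket PW)

lemma buyerSuperHedges_eq_sellerSuperHedges {ξ ζ : ℝ≥0 → CanonicalSpace PW → ℝ}
    (hle : ∀ᵐ ω ∂prob PW, ∀ t ≤ 𝓜.T, ξ t ω ≤ ζ t ω) (z : ℝ) :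
    𝓜.buyerSuperHedges ξ ζ z =
      𝓜.sellerSuperHedges (fun t ω => -ζ t ω) (fun t ω => -ξ t ω) (-z) := by
  ext ⟨τ, φ⟩
  refine forall_congr' fun α => exists_congr fun V => and_congr_right fun _ => ?_
  refine and_congr_left fun hτ => ⟨fun hV => ?_, fun hV => ?_⟩
  · filter_upwards [hV, hτ, hle, τ.le_T] with ω hV hτ hle hT t ht
    rcases ht.lt_or_eq with ht | rfl
    · exact hV t ht
    · exact (neg_le_neg (hle _ hT)).trans hτ
  · filter_upwards [hV] with ω hV t ht
    exact hV t ht.le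

end GameOption.AmbiguousMarket

lemma EReal.sSup_image_coe_eq_neg_sInf (S : Set ℝ) :
    sSup ((fun z : ℝ => (z : EReal)) '' {z | -z ∈ S}) =
      -sInf ((fun x : ℝ => (x : EReal)) '' S) := by
  refine le_antisymm (sSup_le ?_) (EReal.neg_le_of_neg_le (le_sInf ?_))
  · rintro _ ⟨z, hz, rfl⟩
    refine EReal.le_neg_of_le_neg (sInf_le ⟨-z, hz, ?_⟩)
    exact EReal.coe_neg z
  · rintro _ ⟨x, hx, rfl⟩
    refine EReal.neg_le_of_neg_le (le_sSup ⟨-x, ?_, ?_⟩)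
    · simpa using hx
    · exact EReal.coe_neg x

theorem mainTheorem10 (PW : MeasureTheory.Measure GameOption.WienerSpace)
    (hPW : GameOption.IsWienerMeasure PW)
    (𝓜 : GameOption.AmbiguousMarket PW)
    (ξ ζ : NNReal → GameOption.CanonicalSpace PW → ℝ) (h : 𝓜.IsPayoff ξ ζ) :
    𝓜.buyerRobustPrice ξ ζ =
      -𝓜.sellerRobustPrice (fun t ω => -ζ t ω) (fun t ω => -ξ t ω) := by
  simp only [GameOption.AmbiguousMarket.buyerRobustPrice,
    𝓜.buyerSuperHedges_eq_sellerSuperHedges h.le]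
  exact EReal.sSup_image_coe_eq_neg_sInf
    {x | (𝓜.sellerSuperHedges (fun t ω => -ζ t ω) (fun t ω => -ξ t ω) x).Nonempty}
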